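/- \textbf{Arithmetic.} Let $u^{(l)}\ge u^{(h)}>0$ be the unit round-offs of a low and a high precision. Rounding an exact quantity $t$ (the exact result of one operation $+,-,\times,\div,\sqrt{\ }$, or a number being cast down) to precision $q\in\{l,h\}$ yields any value $(1+\delta)t$ with $|\delta|\le u^{(q)}$ (no overflow or underflow). An inner product is computed with exact products, partial sums accumulated from left to right in precision $h$, and the final sum cast down to precision $l$; every other operation is done in precision $l$. For an integer $c>0$ put $\tilde\gamma^{(q)}_k=\dfrac{c\,k\,u^{(q)}}{1-c\,k\,u^{(q)}}$. \textbf{Algorithm.} Let $A\in\mathbb{R}^{m\times n}$, $m\ge n$. For $i=1,\dots,n$: with $x$ the current content of $A[i{:}m,i]$, compute $\sigma=-\mathrm{sign}(x[1])\|x\|_2$ (with $\mathrm{sign}(0)=1$, and $\|x\|_2$ as the square root of an inner product), $v'=x[1]-\sigma$, $\beta=-v'/\sigma$ and $v=(1,x[2]/v',\dots)$ (if $x=0$: $\sigma=\beta=0$, $v=\hat e_1$); overwrite $A[i,i]$ by the computed $\sigma$ and $A[i{+}1{:}m,i]$ by $0$; replace each column $y$ of $A[i{:}m,i{+}1{:}n]$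 by the computed value of $y-(\beta\,(v^\top y))\,v$. Then $\hat R\in\mathbb{R}^{n\times n}$ is the final $A[1{:}n,1{:}n]$, and $\hat Q\in\mathbb{R}^{m\times n}$ is obtained by applying in the same way the computed transformations $n,n-1,\dots,1$ to the columns of $I_{m\times n}$, the first $n$ columns of the identity $I_m$. \textbf{Exact counterparts.} Let $P_i\in\mathbb{R}^{m\times m}$ be the exact Householder transformation, acting on rows $i,\dots,m$, that the formulas above define without rounding from the vector $x$ held by the working array at the start of step $i$ (so $P_i=I_m$ if $x=0$). Put $Q=P_1\cdots P_nI_{m\times n}$, $R=I_{m\times n}^\top P_n\cdots P_1A$, $\Delta Q=\hat Q-Q$ and $\Delta R=\hat R-R$. \textbf{Theorem.} There is an absolute integer constant $c>0$ such that the following holds for all $m\ge n$, all $u^{(l)}\ge u^{(h)}>0$ with $10cn\,u^{(l)}<1$, $cm\,u^{(h)}<1$, $\tilde\gamma^{(l)}_{10n}\le\frac12$ and $n\tilde\gamma^{(h)}_m\le\frac12$, every $A\in\mathbb{R}^{m\times n}$ of full rank $n$, and all rounding errors $\delta$ admitted above. For $j=1,\dots,n$, \[\|\Delta R[:,j]\|_2\le\big(\tilde\gamma^{(l)}_{10n}+n\tilde\gamma^{(h)}_m\big)\|A[:,j]\|_2,\qquad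 \|\Delta R\|_F\le\big(\tilde\gamma^{(l)}_{10n}+n\tilde\gamma^{(h)}_m\big)\|A\|_F,\] \[\|\Delta Q[:,j]\|_2\le\tilde\gamma^{(l)}_{10n}+n\tilde\gamma^{(h)}_m,\qquad \|\Delta Q\|_F\le n^{1/2}\big(\tilde\gamma^{(l)}_{10n}+n\tilde\gamma^{(h)}_m\big).\] -/

import Mathlib

open scoped Matrix Matrix.Norms.Frobenius

noncomputable section

namespace MPHQR

/-- Standard model of floating point arithmetic with unit round-off `u`:
`z` is an admissible computed value of the exact quantity `t` (the exact result of one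
operation `+, -, ×, ÷, √`, or a number that is cast down), i.e. `z = (1 + δ) t` with `|δ| ≤ u`. -/
def Rounds (u t z : ℝ) : Prop := ∃ δ : ℝ, |δ| ≤ u ∧ z = (1 + δ) * t

/-- `γ̃_k = c k u / (1 - c k u)` for the unit round-off `u` and the integer constant `c`. -/
def gammaTilde (c k : ℕ) (u : ℝ) : ℝ := (c * k * u) / (1 - c * k * u)

/-- The sign used in Householder vectors; it is `±1`, with value `1` at `0`. -/
def hhSign (x : ℝ) : ℝ := if 0 ≤ x then 1 else -1

/-- `z` is an admissible computed value of the inner product of `x[i:end]` and `y[i:end]`: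
the products are exact, the partial sums `s` are accumulated from left to right in the precision
with unit round-off `uh`, and the final sum is cast down to the precision with unit round-off
`ul`. -/
def MPDot {m : ℕ} (ul uh : ℝ) (i : Fin m) (x y : Fin m → ℝ) (z : ℝ) : Prop :=
  ∃ s : Fin m → ℝ,
    s i = x i * y i ∧
    (∀ r r' : Fin m, i ≤ r → (r' : ℕ) = r + 1 → Rounds uh (s r + x r' * y r') (s r')) ∧
    (∀ r : Fin m, (r : ℕ) + 1 = m → Rounds ul (s r) z)

/-- `v, β, σ` are admissible computed outputs of `hhvec(x[i:end])`:
`σ = -sign(x[i]) ‖x[i:end]‖₂`, `p = x[i] - σ`, `β = -p / σ`, `v = x[i:end] / p` with leading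
entry `1`. The vector `v` is padded by zeros above row `i`.
If `x[i:end] = 0`, then (division by `0` being `0`) `σ = 0`, `β = 0` and `v = eᵢ`, so the
resulting transformation is the identity. -/
def HHVec {m : ℕ} (ul uh : ℝ) (i : Fin m) (x v : Fin m → ℝ) (β σ : ℝ) : Prop :=
  ∃ d nrm p : ℝ,
    MPDot ul uh i x x d ∧
    Rounds ul (Real.sqrt d) nrm ∧
    σ = -hhSign (x i) * nrm ∧
    Rounds ul (x i - σ) p ∧
    Rounds ul (-p / σ) β ∧
    (∀ r, r < i → v r = 0) ∧
    v i = 1 ∧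
    (∀ r, i < r → Rounds ul (x r / p) (v r))

/-- `y` is an admissible computed value of `x - (β vᵀ x) v` on the rows `i:end`; the rows above
`i` are not touched. -/
def HHApply {m : ℕ} (ul uh : ℝ) (i : Fin m) (v : Fin m → ℝ) (β : ℝ) (x y : Fin m → ℝ) : Prop :=
  (∀ r, r < i → y r = x r) ∧
  ∃ (d q : ℝ) (w : Fin m → ℝ),
    MPDot ul uh i v x d ∧
    Rounds ul (β * d) q ∧
    (∀ r, i ≤ r → Rounds ul (q * v r) (w r)) ∧
    (∀ r, i ≤ r → Rounds ul (x r - w r) (y r))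

/-- `I_{m×n}`: the first `n` columns of the identity of size `m`. -/
def thinId (m n : ℕ) : Matrix (Fin m) (Fin n) ℝ :=
  Matrix.of fun r j => if (r : ℕ) = j then 1 else 0

/-- An execution of mixed precision Householder QR on `A`, followed by the generation of the
thin orthogonal factor. -/
structure Run {m n : ℕ} (hnm : n ≤ m) (ul uh : ℝ) (A : Matrix (Fin m) (Fin n) ℝ) where
  /-- `W k`: content of the array `A` after `k` passes through the loop. -/
  W : Fin (n + 1) → Matrix (Fin m) (Fin n) ℝ
  /-- `V i`: computed Householder vector of pass `i`. -/
  V : Fin n → Fin m → ℝ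
  /-- Computed Householder constants. -/
  β : Fin n → ℝ
  /-- Computed values of `σ`. -/
  σ : Fin n → ℝ
  /-- `X k`: computed value of `P̂ₖ₊₁ ⋯ P̂ₙ I_{m×n}`. -/
  X : Fin (n + 1) → Matrix (Fin m) (Fin n) ℝ
  W_zero : W 0 = A
  hhvec : ∀ i : Fin n,
    HHVec ul uh (Fin.castLE hnm i) (fun r => W i.castSucc r i) (V i) (β i) (σ i)
  /-- Columns already processed are not touched. -/
  W_left : ∀ (i j : Fin n), j < i → ∀ r, W i.succ r j = W i.castSucc r j
  /-- Column `i`: the diagonal entry is overwritten by `σ`, the entries below it by zeros. -/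
  W_above : ∀ (i : Fin n) (r : Fin m), (r : ℕ) < i → W i.succ r i = W i.castSucc r i
  W_diag : ∀ i : Fin n, W i.succ (Fin.castLE hnm i) i = σ i
  W_below : ∀ (i : Fin n) (r : Fin m), (i : ℕ) < r → W i.succ r i = 0
  /-- The transformation is applied to the columns to the right of column `i`. -/
  W_right : ∀ (i j : Fin n), i < j →
    HHApply ul uh (Fin.castLE hnm i) (V i) (β i)
      (fun r => W i.castSucc r j) (fun r => W i.succ r j)
  X_last : X (Fin.last n) = thinId m n
  /-- The transformations are applied to `I_{m×n}` in reverse order. -/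
  X_step : ∀ (i j : Fin n),
    HHApply ul uh (Fin.castLE hnm i) (V i) (β i)
      (fun r => X i.succ r j) (fun r => X i.castSucc r j)

/-- Exact `σ = -sign(x[i]) ‖x[i:end]‖₂`. -/
def exactSigma {m : ℕ} (i : Fin m) (x : Fin m → ℝ) : ℝ :=
  -hhSign (x i) * Real.sqrt (∑ r ∈ Finset.Ici i, x r ^ 2)

/-- Exact Householder vector of `x[i:end]`, normalised to leading entry `1`, padded by zeros. -/
def exactV {m : ℕ} (i : Fin m) (x : Fin m → ℝ) : Fin m → ℝ := fun r =>
  if r < i then 0 else if r = i then 1 else x r / (x i - exactSigma i x)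

/-- Exact Householder constant for `exactV`. -/
def exactBeta {m : ℕ} (i : Fin m) (x : Fin m → ℝ) : ℝ :=
  -(x i - exactSigma i x) / exactSigma i x

/-- Exact Householder transformation `I - β v vᵀ` zeroing `x` below row `i`
(the identity if `x[i:end] = 0`). -/
def exactP {m : ℕ} (i : Fin m) (x : Fin m → ℝ) : Matrix (Fin m) (Fin m) ℝ :=
  1 - exactBeta i x • Matrix.vecMulVec (exactV i x) (exactV i x)

namespace Run

variable {m n : ℕ} {hnm : n ≤ m} {ul uh : ℝ} {A : Matrix (Fin m) (Fin n) ℝ}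

/-- Computed `R̂ = A[1:n, 1:n]` at the end of the loop. -/
def Rhat (run : Run hnm ul uh A) : Matrix (Fin n) (Fin n) ℝ :=
  (run.W (Fin.last n)).submatrix (Fin.castLE hnm) id

/-- Computed thin factor `Q̂ = fl(P̂₁ ⋯ P̂ₙ I_{m×n})`. -/
def Qhat (run : Run hnm ul uh A) : Matrix (Fin m) (Fin n) ℝ := run.X 0

/-- `Pᵢ`: the exact Householder transformation for the `i`-th pass, i.e. for the column
that is held by the working array when pass `i` starts. -/
def P (run : Run hnm ul uh A) (i : Fin n) : Matrix (Fin m) (Fin m) ℝ :=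
  exactP (Fin.castLE hnm i) (fun r => run.W i.castSucc r i)

/-- `Q = P₁ ⋯ Pₙ I_{m×n}`. -/
def Q (run : Run hnm ul uh A) : Matrix (Fin m) (Fin n) ℝ :=
  (List.ofFn run.P).prod * thinId m n

/-- `R = I_{m×n}ᵀ Pₙ ⋯ P₁ A`. -/
def R (run : Run hnm ul uh A) : Matrix (Fin n) (Fin n) ℝ :=
  (thinId m n)ᵀ * ((List.ofFn run.P).reverse.prod * A)

end Run

/-- Euclidean norm of column `j`. -/
def colNorm {m n : ℕ} (M : Matrix (Fin m) (Fin n) ℝ) (j : Fin n) : ℝ :=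
  ‖(WithLp.toLp 2 (fun r => M r j) : EuclideanSpace ℝ (Fin m))‖

end MPHQR

end

/-!
Exact and computed quantities are compared through relative precision in the sense of Olver,
`z = exp s * t` with `|s| ≤ ε`, whose exponents simply add up under products and quotients; sums
keep it when all terms have the same sign. The sign of `σ` makes `x i - σ` such a sum, so with
`ε = 2 ul + 2 m uh` the computed reflector `(v, β)` has entrywise precision a small multiple of `ε`.
Applying it replaces each summand of the exact `y r - ∑ s, β (v s y s) v r` by one of precision
`18 ε`, and since `β ‖v‖² ≤ 2` this changes a column `y` by at most
`3 (e ^ (18 ε) - 1) ‖y‖ ≤ (e ^ (54 ε) - 1) ‖y‖` in norm. The exact reflectors are orthogonal, so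
`n` steps change a column by a relative error of at most
`e ^ (54 n ε) - 1 ≤ 108 n ε = 216 n ul + 216 m n uh`, which `c = 216` absorbs.
-/

open WithLp (toLp)

namespace MPHQR

/-! ### Relative precision -/

/-- `z` approximates `t` to relative precision `ε` in the sense of F. W. J. Olver: `z = exp s * t`
with `|s| ≤ ε`. Unlike the factors `1 + δ` of `Rounds`, the exponents simply add up under products
and quotients. -/
def RelPrec (ε t z : ℝ) : Prop := ∃ s : ℝ, |s| ≤ ε ∧ z = Real.exp s * t

namespace RelPrec

variable {ε ε' s t y z : ℝ}

theorem refl (hε : 0 ≤ ε) (t : ℝ) : RelPrec ε t t := ⟨0, by simpa using hε, by simp⟩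

theorem nonneg (h : RelPrec ε t z) : 0 ≤ ε :=
  let ⟨_, hs, _⟩ := h
  (abs_nonneg _).trans hs

theorem mono (h : RelPrec ε t z) (hε : ε ≤ ε') : RelPrec ε' t z :=
  let ⟨s, hs, hz⟩ := h
  ⟨s, hs.trans hε, hz⟩

theorem trans (h : RelPrec ε t y) (h' : RelPrec ε' y z) : RelPrec (ε + ε') t z := by
  obtain ⟨a, ha, rfl⟩ := h
  obtain ⟨b, hb, rfl⟩ := h'
  exact ⟨a + b, (abs_add_le a b).trans (add_le_add ha hb), by rw [Real.exp_add]; ring⟩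

theorem const_mul (a : ℝ) (h : RelPrec ε t z) : RelPrec ε (a * t) (a * z) := by
  obtain ⟨s, hs, rfl⟩ := h
  exact ⟨s, hs, by ring⟩

theorem neg (h : RelPrec ε t z) : RelPrec ε (-t) (-z) := by
  simpa using h.const_mul (-1)

theorem inv (h : RelPrec ε t z) : RelPrec ε t⁻¹ z⁻¹ := by
  obtain ⟨s, hs, rfl⟩ := h
  exact ⟨-s, by rwa [abs_neg], by rw [mul_inv, Real.exp_neg]⟩

theorem mul (h : RelPrec ε s y) (h' : RelPrec ε' t z) : RelPrec (ε + ε') (s * t) (y * z) := by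
  obtain ⟨a, ha, rfl⟩ := h
  obtain ⟨b, hb, rfl⟩ := h'
  exact ⟨a + b, (abs_add_le a b).trans (add_le_add ha hb), by rw [Real.exp_add]; ring⟩

theorem div (h : RelPrec ε s y) (h' : RelPrec ε' t z) : RelPrec (ε + ε') (s / t) (y / z) := by
  simpa only [div_eq_mul_inv] using h.mul h'.inv

theorem sqrt (h : RelPrec ε t z) : RelPrec (ε / 2) √t √z := by
  obtain ⟨s, hs, rfl⟩ := h
  refine ⟨s / 2, ?_, by rw [Real.sqrt_mul (Real.exp_nonneg s), Real.exp_half]⟩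
  rw [abs_div, abs_two]
  gcongr

theorem iff_of_nonneg (hε : 0 ≤ ε) (ht : 0 ≤ t) :
    RelPrec ε t z ↔ Real.exp (-ε) * t ≤ z ∧ z ≤ Real.exp ε * t := by
  constructor
  · rintro ⟨s, hs, rfl⟩
    obtain ⟨hs₁, hs₂⟩ := abs_le.1 hs
    constructor <;> gcongr
  · rintro ⟨hlow, hupp⟩
    rcases ht.eq_or_lt with rfl | ht
    · obtain rfl : z = 0 := by linarith
      exact refl hε 0
    · have hz : 0 < z / t := div_pos ((by positivity : 0 < Real.exp (-ε) * t).trans_le hlow) ht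
      refine ⟨Real.log (z / t), abs_le.2 ⟨?_, ?_⟩, ?_⟩
      · rwa [Real.le_log_iff_exp_le hz, le_div_iff₀ ht]
      · rwa [Real.log_le_iff_le_exp hz, div_le_iff₀ ht]
      · rw [Real.exp_log hz, div_mul_cancel₀ z ht.ne']

theorem add_of_nonneg (hs : 0 ≤ s) (ht : 0 ≤ t) (hy : RelPrec ε s y) (hz : RelPrec ε t z) :
    RelPrec ε (s + t) (y + z) := by
  have hε := hy.nonneg
  rw [iff_of_nonneg hε (add_nonneg hs ht), mul_add, mul_add]
  rw [iff_of_nonneg hε hs] at hy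
  rw [iff_of_nonneg hε ht] at hz
  exact ⟨add_le_add hy.1 hz.1, add_le_add hy.2 hz.2⟩

theorem sum_of_nonneg {ι : Type*} {S : Finset ι} {f g : ι → ℝ} (hε : 0 ≤ ε)
    (hf : ∀ r ∈ S, 0 ≤ f r) (h : ∀ r ∈ S, RelPrec ε (f r) (g r)) :
    RelPrec ε (∑ r ∈ S, f r) (∑ r ∈ S, g r) := by
  rw [iff_of_nonneg hε (Finset.sum_nonneg hf), Finset.mul_sum, Finset.mul_sum]
  exact ⟨Finset.sum_le_sum fun r hr => ((iff_of_nonneg hε (hf r hr)).1 (h r hr)).1,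
    Finset.sum_le_sum fun r hr => ((iff_of_nonneg hε (hf r hr)).1 (h r hr)).2⟩

theorem exists_eq_sum {ι : Type*} {S : Finset ι} {f : ι → ℝ} (h : RelPrec ε (∑ r ∈ S, f r) z) :
    ∃ g : ι → ℝ, (∀ r, RelPrec ε (f r) (g r)) ∧ z = ∑ r ∈ S, g r := by
  obtain ⟨s, hs, rfl⟩ := h
  exact ⟨fun r => Real.exp s * f r, fun r => ⟨s, hs, rfl⟩, Finset.mul_sum ..⟩

theorem abs_sub_le (h : RelPrec ε t z) : |z - t| ≤ (Real.exp ε - 1) * |t| := by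
  obtain ⟨s, hs, rfl⟩ := h
  have hexp : |Real.exp s - 1| ≤ Real.exp |s| - 1 := by
    rcases le_total 0 s with h0 | h0
    · rw [abs_of_nonneg h0, abs_of_nonneg (by simpa using h0)]
    · rw [abs_of_nonpos h0, abs_of_nonpos (by simpa using h0)]
      linarith [Real.one_le_cosh s, Real.cosh_eq s]
  rw [← sub_one_mul, abs_mul]
  gcongr
  exact hexp.trans (by gcongr)

end RelPrec

theorem Rounds.relPrec {u t z : ℝ} (hu : u ≤ 1 / 2) (h : Rounds u t z) : RelPrec (2 * u) t z := by
  obtain ⟨δ, hδ, rfl⟩ := h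
  obtain ⟨hδ₁, hδ₂⟩ := abs_le.1 hδ
  have hpos : 0 < 1 + δ := by linarith
  refine ⟨Real.log (1 + δ), abs_le.2 ⟨?_, ?_⟩, by rw [Real.exp_log hpos]⟩
  · refine le_trans ?_ (Real.one_sub_inv_le_log_of_pos hpos)
    have hinv : (1 + δ)⁻¹ ≤ 1 + 2 * u := by
      rw [inv_le_iff_one_le_mul₀ hpos]
      nlinarith
    linarith
  · linarith [Real.log_le_sub_one_of_pos hpos]

/-! ### Mixed precision inner products -/

/-- Relative precision to which every product `x r * y r` enters the computed mixed precision
inner product of vectors of length at most `m`. -/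
def dotPrec (m : ℕ) (ul uh : ℝ) : ℝ := 2 * ul + m * (2 * uh)

section Dot

variable {m : ℕ} {ul uh : ℝ} {i : Fin m}

theorem exists_relPrec_partialSum (huh : uh ∈ Set.Icc 0 (1 / 2)) {t s : Fin m → ℝ} (h₀ : s i = t i)
    (hs : ∀ r r' : Fin m, i ≤ r → (r' : ℕ) = r + 1 → Rounds uh (s r + t r') (s r'))
    {k : ℕ} (hik : (i : ℕ) ≤ k) (hk : k < m) :
    ∃ g : Fin m → ℝ, (∀ r, RelPrec (k * (2 * uh)) (t r) (g r)) ∧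
      s ⟨k, hk⟩ = ∑ r ∈ Finset.Icc i ⟨k, hk⟩, g r := by
  induction k, hik using Nat.le_induction with
  | base =>
    exact ⟨t, fun r => .refl (mul_nonneg i.val.cast_nonneg (by linarith [huh.1])) _, by simp [h₀]⟩
  | succ k hik ih =>
    obtain ⟨g, hg, hsum⟩ := ih (by omega)
    set a : Fin m := ⟨k, by omega⟩
    set b : Fin m := ⟨k + 1, hk⟩
    have hb : b ∉ Finset.Icc i a := by simp [a, b, Fin.le_def]
    have hIcc : Finset.Icc i b = insert b (Finset.Icc i a) := by
      ext r
      simp only [Finset.mem_Icc, Finset.mem_insert, Fin.le_def, Fin.ext_iff, a, b]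
      omega
    have hround : RelPrec (2 * uh) (∑ r ∈ Finset.Icc i b, Function.update g b (t b) r) (s b) := by
      rw [hIcc, Finset.sum_insert hb, Finset.sum_update_of_notMem hb, Function.update_self,
        ← hsum, add_comm]
      exact (hs a b hik rfl).relPrec huh.2
    obtain ⟨g', hg', hsum'⟩ := hround.exists_eq_sum
    refine ⟨g', fun r => ?_, hsum'⟩
    have hupd : RelPrec (k * (2 * uh)) (t r) (Function.update g b (t b) r) := by
      rcases eq_or_ne r b with rfl | hr
      · rw [Function.update_self]
        exact .refl (mul_nonneg k.cast_nonneg (by linarith [huh.1])) _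
      · simpa only [Function.update_of_ne hr] using hg r
    exact (hupd.trans (hg' r)).mono (by push_cast; linarith)

theorem MPDot.exists_relPrec (hul : ul ≤ 1 / 2) (huh : uh ∈ Set.Icc 0 (1 / 2))
    {x y : Fin m → ℝ} {z : ℝ} (h : MPDot ul uh i x y z) :
    ∃ g : Fin m → ℝ, (∀ r, RelPrec (dotPrec m ul uh) (x r * y r) (g r)) ∧
      z = ∑ r ∈ Finset.Ici i, g r := by
  obtain ⟨s, h₀, hs, hz⟩ := h
  have hi := i.2
  obtain ⟨g, hg, hsum⟩ := exists_relPrec_partialSum huh (t := fun r => x r * y r) h₀ hs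
    (k := m - 1) (by omega) (by omega)
  have hIcc : Finset.Icc i ⟨m - 1, by omega⟩ = Finset.Ici i := by
    ext r
    have := r.2
    simp only [Finset.mem_Icc, Finset.mem_Ici, Fin.le_def]
    omega
  rw [hIcc] at hsum
  have hcast := (hz ⟨m - 1, by omega⟩ (by simp only; omega)).relPrec hul
  rw [hsum] at hcast
  obtain ⟨g', hg', hsum'⟩ := hcast.exists_eq_sum
  refine ⟨g', fun r => ((hg r).trans (hg' r)).mono ?_, hsum'⟩
  have hm : ((m - 1 : ℕ) : ℝ) ≤ m := by exact_mod_cast m.sub_le 1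
  rw [dotPrec, add_comm]
  gcongr
  linarith [huh.1]

theorem two_mul_le_dotPrec (huh : 0 ≤ uh) : 2 * ul ≤ dotPrec m ul uh :=
  le_add_of_nonneg_right (by positivity)

theorem dotPrec_nonneg (hul : 0 ≤ ul) (huh : 0 ≤ uh) : 0 ≤ dotPrec m ul uh := by
  unfold dotPrec
  positivity

theorem one_le_exp_mul_dotPrec (hul : 0 ≤ ul) (huh : 0 ≤ uh) (k : ℕ) :
    1 ≤ Real.exp (k * dotPrec m ul uh) :=
  Real.one_le_exp (mul_nonneg k.cast_nonneg (dotPrec_nonneg hul huh))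

end Dot

/-! ### Euclidean norms of tuples -/

section EuclideanNorm

variable {ι κ : Type*} [Fintype ι] [Fintype κ]

theorem norm_toLp_le_of_abs_le {x y : ι → ℝ} (h : ∀ r, |x r| ≤ |y r|) :
    ‖toLp 2 x‖ ≤ ‖toLp 2 y‖ := by
  rw [EuclideanSpace.norm_eq, EuclideanSpace.norm_eq]
  exact Real.sqrt_le_sqrt (Finset.sum_le_sum fun r _ => pow_le_pow_left₀ (norm_nonneg _) (h r) 2)

theorem norm_toLp_le_add {x y z : ι → ℝ} {a b : ℝ} (ha : 0 ≤ a) (hb : 0 ≤ b)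
    (h : ∀ r, |z r| ≤ a * |x r| + b * |y r|) : ‖toLp 2 z‖ ≤ a * ‖toLp 2 x‖ + b * ‖toLp 2 y‖ := by
  have habs (x : ι → ℝ) : ‖toLp 2 |x|‖ = ‖toLp 2 x‖ := by simp [EuclideanSpace.norm_eq]
  calc ‖toLp 2 z‖ ≤ ‖toLp 2 (a • |x| + b • |y|)‖ :=
        norm_toLp_le_of_abs_le fun r => (h r).trans (le_abs_self _)
    _ ≤ ‖a • toLp 2 |x|‖ + ‖b • toLp 2 |y|‖ := norm_add_le _ _
    _ = a * ‖toLp 2 x‖ + b * ‖toLp 2 y‖ := by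
        rw [norm_smul, norm_smul, habs, habs, Real.norm_of_nonneg ha, Real.norm_of_nonneg hb]

theorem norm_toLp_comp_le (x : ι → ℝ) {f : κ → ι} (hf : f.Injective) :
    ‖toLp 2 (x ∘ f)‖ ≤ ‖toLp 2 x‖ := by
  rw [EuclideanSpace.norm_eq, EuclideanSpace.norm_eq]
  refine Real.sqrt_le_sqrt ?_
  exact (Finset.sum_map Finset.univ ⟨f, hf⟩ fun r => ‖x r‖ ^ 2).symm.trans_le <|
    Finset.sum_le_univ_sum_of_nonneg fun r => sq_nonneg _

theorem sum_abs_mul_abs_le (x y : ι → ℝ) :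
    ∑ r, |x r| * |y r| ≤ ‖toLp 2 x‖ * ‖toLp 2 y‖ := by
  rw [EuclideanSpace.norm_eq, EuclideanSpace.norm_eq]
  exact Real.sum_mul_le_sqrt_mul_sqrt _ _ _

theorem norm_toLp_mulVec_of_mem_orthogonalGroup [DecidableEq ι] {M : Matrix ι ι ℝ}
    (hM : M ∈ Matrix.orthogonalGroup ι ℝ) (x : ι → ℝ) : ‖toLp 2 (M *ᵥ x)‖ = ‖toLp 2 x‖ := by
  rw [← Matrix.toEuclideanCLM_toLp (𝕜 := ℝ)]
  exact ContinuousLinearMap.norm_map_of_mem_unitary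
    (Unitary.map_mem (Matrix.toEuclideanCLM (𝕜 := ℝ)) hM) _

end EuclideanNorm

section ColNorm

variable {m m' n : ℕ}

theorem norm_eq_norm_colNorm (M : Matrix (Fin m) (Fin n) ℝ) : ‖M‖ = ‖toLp 2 (colNorm M)‖ := by
  rw [Matrix.frobenius_norm_def, EuclideanSpace.norm_eq, Real.sqrt_eq_rpow, Finset.sum_comm]
  simp only [colNorm, EuclideanSpace.norm_eq, Real.norm_eq_abs, sq_abs, Real.rpow_two,
    Real.sq_sqrt (Finset.sum_nonneg fun _ _ => sq_nonneg _)]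

theorem colNorm_nonneg (M : Matrix (Fin m) (Fin n) ℝ) (j : Fin n) : 0 ≤ colNorm M j :=
  norm_nonneg _

theorem norm_le_of_colNorm_le {M : Matrix (Fin m) (Fin n) ℝ} {y : Fin n → ℝ}
    (h : ∀ j, colNorm M j ≤ y j) : ‖M‖ ≤ ‖toLp 2 y‖ := by
  rw [norm_eq_norm_colNorm]
  exact norm_toLp_le_of_abs_le fun j => abs_le_abs_of_nonneg (colNorm_nonneg M j) (h j)

theorem norm_le_mul_of_colNorm_le {M : Matrix (Fin m) (Fin n) ℝ} {B : Matrix (Fin m') (Fin n) ℝ}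
    {b : ℝ} (hb : 0 ≤ b) (h : ∀ j, colNorm M j ≤ b * colNorm B j) : ‖M‖ ≤ b * ‖B‖ := by
  rw [norm_eq_norm_colNorm B, ← Real.norm_of_nonneg hb, ← norm_smul, ← WithLp.toLp_smul]
  exact norm_le_of_colNorm_le h

theorem norm_le_sqrt_mul_of_colNorm_le {M : Matrix (Fin m) (Fin n) ℝ} {b : ℝ} (hb : 0 ≤ b)
    (h : ∀ j, colNorm M j ≤ b) : ‖M‖ ≤ √n * b := by
  refine (norm_le_of_colNorm_le h).trans_eq ?_
  simp [EuclideanSpace.norm_eq, Real.sqrt_sq hb]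

theorem colNorm_submatrix_le (M : Matrix (Fin m) (Fin n) ℝ) {f : Fin m' → Fin m}
    (hf : f.Injective) (j : Fin n) : colNorm (M.submatrix f id) j ≤ colNorm M j :=
  norm_toLp_comp_le (M.col j) hf

theorem colNorm_sub_mul (M : Matrix (Fin m) (Fin n) ℝ) (N : Matrix (Fin m) (Fin m') ℝ)
    (B : Matrix (Fin m') (Fin n) ℝ) (j : Fin n) :
    colNorm (M - N * B) j = ‖toLp 2 (M.col j - N *ᵥ B.col j)‖ :=
  rfl

end ColNorm

/-! ### Exact Householder transformations -/

section Reflector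

variable {ι R : Type*} [Fintype ι] [DecidableEq ι] [CommRing R]

theorem one_sub_smul_vecMulVec_mem_orthogonalGroup {b : R} {v : ι → R}
    (h : b * (b * (v ⬝ᵥ v)) = 2 * b) :
    1 - b • Matrix.vecMulVec v v ∈ Matrix.orthogonalGroup ι R := by
  set M := Matrix.vecMulVec v v with hM
  have hMM : M * M = (v ⬝ᵥ v) • M := by
    rw [hM, Matrix.vecMulVec_mul_vecMulVec, Matrix.vecMulVec_smul]
  have hMT : Mᵀ = M := Matrix.transpose_vecMulVec v v
  have hsq : b • M * b • M = (2 * b) • M := by rw [smul_mul_smul_comm, hMM, smul_smul, mul_assoc, h]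
  rw [Matrix.mem_orthogonalGroup_iff, Matrix.transpose_sub, Matrix.transpose_one,
    Matrix.transpose_smul, hMT, mul_sub, sub_mul, sub_mul, hsq, mul_smul, two_smul, one_mul,
    one_mul, mul_one]
  abel

end Reflector

section Exact

variable {m : ℕ} {i : Fin m} {x : Fin m → ℝ}

theorem hhSign_mul_self (a : ℝ) : hhSign a * a = |a| := by
  unfold hhSign
  split_ifs with h
  · rw [one_mul, abs_of_nonneg h]
  · rw [neg_one_mul, abs_of_neg (not_le.1 h)]

theorem hhSign_mul_hhSign (a : ℝ) : hhSign a * hhSign a = 1 := by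
  unfold hhSign
  split_ifs <;> norm_num

theorem exactSigma_mul_self (i : Fin m) (x : Fin m → ℝ) :
    exactSigma i x * exactSigma i x = ∑ r ∈ Finset.Ici i, x r ^ 2 := by
  rw [exactSigma, mul_mul_mul_comm, neg_mul_neg, hhSign_mul_hhSign, one_mul,
    Real.mul_self_sqrt (Finset.sum_nonneg fun _ _ => sq_nonneg _)]

theorem sub_exactSigma (i : Fin m) (x : Fin m → ℝ) :
    x i - exactSigma i x = hhSign (x i) * (|x i| + √(∑ r ∈ Finset.Ici i, x r ^ 2)) := by
  rw [← hhSign_mul_self, mul_add, ← mul_assoc, hhSign_mul_hhSign, exactSigma]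
  ring

theorem eq_zero_of_exactSigma_eq_zero (h : exactSigma i x = 0) {r : Fin m} (hr : i ≤ r) :
    x r = 0 := by
  have hsum : ∑ r ∈ Finset.Ici i, x r ^ 2 = 0 := by rw [← exactSigma_mul_self, h, mul_zero]
  exact pow_eq_zero_iff two_ne_zero |>.1 <|
    (Finset.sum_eq_zero_iff_of_nonneg fun _ _ => sq_nonneg _).1 hsum r (Finset.mem_Ici.2 hr)

theorem sub_exactSigma_ne_zero (h : exactSigma i x ≠ 0) : x i - exactSigma i x ≠ 0 := by
  have hs := hhSign_mul_hhSign (x i)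
  rw [exactSigma, mul_ne_zero_iff] at h
  have hsqrt : 0 < √(∑ r ∈ Finset.Ici i, x r ^ 2) := h.2.lt_of_le' (Real.sqrt_nonneg _)
  rw [sub_exactSigma]
  exact mul_ne_zero (neg_ne_zero.1 h.1) (by positivity)

theorem exactV_dotProduct (i : Fin m) (x y : Fin m → ℝ) :
    exactV i x ⬝ᵥ y = y i + (∑ r ∈ Finset.Ioi i, x r * y r) / (x i - exactSigma i x) := by
  have hsupp : ∑ r ∈ Finset.Ici i, exactV i x r * y r = ∑ r, exactV i x r * y r :=
    Finset.sum_subset (Finset.subset_univ _) fun r _ hr => by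
      rw [exactV, if_pos (not_le.1 (mt Finset.mem_Ici.2 hr)), zero_mul]
  rw [dotProduct, ← hsupp, ← Finset.add_sum_Ioi_eq_sum_Ici, Finset.sum_div]
  congr 1
  · simp [exactV]
  · refine Finset.sum_congr rfl fun r hr => ?_
    have hr := Finset.mem_Ioi.1 hr
    rw [exactV, if_neg hr.not_gt, if_neg hr.ne']
    ring

theorem sum_Ioi_sq (i : Fin m) (x : Fin m → ℝ) :
    ∑ r ∈ Finset.Ioi i, x r ^ 2 = -(x i - exactSigma i x) * (x i + exactSigma i x) := by
  linear_combination Finset.add_sum_Ioi_eq_sum_Ici (f := fun r => x r ^ 2) i -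
    exactSigma_mul_self i x

theorem exactV_dotProduct_self (h : exactSigma i x ≠ 0) : exactV i x ⬝ᵥ x = -exactSigma i x := by
  have := sub_exactSigma_ne_zero h
  simp only [exactV_dotProduct, ← sq, sum_Ioi_sq]
  field_simp
  ring

theorem exactBeta_mul_exactV_dotProduct_exactV (h : exactSigma i x ≠ 0) :
    exactBeta i x * (exactV i x ⬝ᵥ exactV i x) = 2 := by
  have hp := sub_exactSigma_ne_zero h
  have hsum : ∑ r ∈ Finset.Ioi i, x r * exactV i x r =
      (∑ r ∈ Finset.Ioi i, x r ^ 2) / (x i - exactSigma i x) := by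
    rw [Finset.sum_div]
    refine Finset.sum_congr rfl fun r hr => ?_
    have hr := Finset.mem_Ioi.1 hr
    rw [exactV, if_neg hr.not_gt, if_neg hr.ne']
    ring
  have hi : exactV i x i = 1 := by simp [exactV]
  rw [exactV_dotProduct, hi, hsum, sum_Ioi_sq, exactBeta]
  field_simp
  ring

theorem exactBeta_eq_zero (h : exactSigma i x = 0) : exactBeta i x = 0 := by
  rw [exactBeta, h, div_zero]

theorem exactP_mem_orthogonalGroup (i : Fin m) (x : Fin m → ℝ) :
    exactP i x ∈ Matrix.orthogonalGroup (Fin m) ℝ := by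
  refine one_sub_smul_vecMulVec_mem_orthogonalGroup ?_
  by_cases h : exactSigma i x = 0
  · simp [exactBeta_eq_zero h]
  · rw [exactBeta_mul_exactV_dotProduct_exactV h, mul_comm]

theorem abs_exactBeta_mul_norm_sq_le (i : Fin m) (x : Fin m → ℝ) :
    |exactBeta i x| * ‖toLp 2 (exactV i x)‖ ^ 2 ≤ 2 := by
  by_cases h : exactSigma i x = 0
  · simp [exactBeta_eq_zero h]
  · have hnorm : ‖toLp 2 (exactV i x)‖ ^ 2 = exactV i x ⬝ᵥ exactV i x := by
      simp only [EuclideanSpace.real_norm_sq_eq, dotProduct, ← sq]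
    rw [← abs_of_nonneg (sq_nonneg ‖_‖), ← abs_mul, hnorm,
      exactBeta_mul_exactV_dotProduct_exactV h, abs_two]

theorem exactP_mulVec (i : Fin m) (x y : Fin m → ℝ) (r : Fin m) :
    (exactP i x *ᵥ y) r = y r - exactBeta i x * (exactV i x ⬝ᵥ y) * exactV i x r := by
  simp only [exactP, Matrix.sub_mulVec, Matrix.one_mulVec, Matrix.smul_mulVec,
    Matrix.vecMulVec_mulVec, op_smul_eq_smul, Pi.sub_apply, Pi.smul_apply, smul_eq_mul]
  ring

theorem exactP_mulVec_eq_self {y : Fin m → ℝ} (hy : ∀ r, i ≤ r → y r = 0) :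
    exactP i x *ᵥ y = y := by
  have hdot : exactV i x ⬝ᵥ y = 0 := by
    rw [exactV_dotProduct, hy i le_rfl, Finset.sum_eq_zero, zero_div, add_zero]
    exact fun r hr => by rw [hy r (Finset.mem_Ioi.1 hr).le, mul_zero]
  ext r
  rw [exactP_mulVec, hdot]
  ring

theorem exactP_mulVec_self (i : Fin m) (x : Fin m → ℝ) (r : Fin m) :
    (exactP i x *ᵥ x) r = if r < i then x r else if r = i then exactSigma i x else 0 := by
  by_cases h : exactSigma i x = 0
  · have hx : ∀ r, i ≤ r → x r = 0 := fun r => eq_zero_of_exactSigma_eq_zero h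
    rw [exactP_mulVec_eq_self hx]
    grind
  · have hp := sub_exactSigma_ne_zero h
    rw [exactP_mulVec, exactV_dotProduct_self h, exactBeta, exactV]
    split_ifs with h₁ h₂
    · ring
    · subst h₂; field_simp; ring
    · field_simp; ring

end Exact

/-! ### Computed Householder vectors and their application -/

section Computed

variable {m : ℕ} {ul uh : ℝ} {i : Fin m} {x v : Fin m → ℝ} {β σ : ℝ}

theorem MPDot.relPrec_sum_sq (hul : ul ∈ Set.Icc 0 (1 / 2)) (huh : uh ∈ Set.Icc 0 (1 / 2)) {d : ℝ}
    (h : MPDot ul uh i x x d) :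
    RelPrec (dotPrec m ul uh) (∑ r ∈ Finset.Ici i, x r ^ 2) d := by
  obtain ⟨g, hg, rfl⟩ := h.exists_relPrec hul.2 huh
  simp only [← sq] at hg
  exact .sum_of_nonneg (dotPrec_nonneg hul.1 huh.1) (fun r _ => sq_nonneg _) fun r _ => hg r

/-- The choice of sign makes `x i - σ` a sum of two numbers of equal sign, without cancellation. -/
theorem RelPrec.sub_exactSigma {ε nrm : ℝ} (h : RelPrec ε √(∑ r ∈ Finset.Ici i, x r ^ 2) nrm) :
    RelPrec ε (x i - exactSigma i x) (x i - -hhSign (x i) * nrm) := by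
  have hsum : x i - -hhSign (x i) * nrm = hhSign (x i) * (|x i| + nrm) := by
    rw [← hhSign_mul_self, mul_add, ← mul_assoc, hhSign_mul_hhSign]
    ring
  rw [MPHQR.sub_exactSigma, hsum]
  exact ((RelPrec.refl h.nonneg _).add_of_nonneg (abs_nonneg _) (Real.sqrt_nonneg _) h).const_mul _

theorem HHVec.relPrec (hul : ul ∈ Set.Icc 0 (1 / 2)) (huh : uh ∈ Set.Icc 0 (1 / 2))
    (h : HHVec ul uh i x v β σ) :
    RelPrec (2 * dotPrec m ul uh) (exactSigma i x) σ ∧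
      RelPrec (6 * dotPrec m ul uh) (exactBeta i x) β ∧
      ∀ r, RelPrec (4 * dotPrec m ul uh) (exactV i x r) (v r) := by
  obtain ⟨d, nrm, p, hd, hnrm, rfl, hp, hβ, hv_above, hv_i, hv_below⟩ := h
  have hround {t z : ℝ} (h : Rounds ul t z) : RelPrec (dotPrec m ul uh) t z :=
    (h.relPrec hul.2).mono (two_mul_le_dotPrec huh.1)
  have hε : 0 ≤ dotPrec m ul uh := dotPrec_nonneg hul.1 huh.1
  have hnrm : RelPrec (2 * dotPrec m ul uh) √(∑ r ∈ Finset.Ici i, x r ^ 2) nrm :=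
    ((hd.relPrec_sum_sq hul huh).sqrt.trans (hround hnrm)).mono (by linarith)
  have hσ := hnrm.const_mul (-hhSign (x i))
  have hp : RelPrec (3 * dotPrec m ul uh) (x i - exactSigma i x) p :=
    (hnrm.sub_exactSigma.trans (hround hp)).mono (by linarith)
  refine ⟨hσ, ((hp.neg.div hσ).trans (hround hβ)).mono (by linarith), fun r => ?_⟩
  unfold exactV
  split_ifs with hr hri
  · rw [hv_above r hr]
    exact .refl (by positivity) 0
  · rw [hri, hv_i]
    exact .refl (by positivity) 1
  · have hx : RelPrec (3 * dotPrec m ul uh) (x r / (x i - exactSigma i x)) (x r / p) :=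
      ((RelPrec.refl le_rfl (x r)).div hp).mono (by linarith)
    exact (hx.trans (hround (hv_below r (by order)))).mono (by linarith)

theorem HHApply.exists_relPrec (hul : ul ≤ 1 / 2) (huh : uh ∈ Set.Icc 0 (1 / 2))
    {ε ε' b : ℝ} {V y : Fin m → ℝ} (hβ : RelPrec ε b β) (hv : ∀ r, RelPrec ε' (V r) (v r))
    (h : HHApply ul uh i v β x y) {r : Fin m} (hr : i ≤ r) :
    ∃ (a : ℝ) (g : Fin m → ℝ),
      RelPrec (ε + 2 * ε' + 4 * dotPrec m ul uh) (x r) a ∧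
      (∀ s, RelPrec (ε + 2 * ε' + 4 * dotPrec m ul uh) (b * V r * (V s * x s)) (g s)) ∧
      y r = a - ∑ s ∈ Finset.Ici i, g s := by
  obtain ⟨-, d, q, w, hd, hq, hw, hy⟩ := h
  have hround {t z : ℝ} (h : Rounds ul t z) : RelPrec (dotPrec m ul uh) t z :=
    (h.relPrec hul).mono (two_mul_le_dotPrec huh.1)
  obtain ⟨f, hf, rfl⟩ := hd.exists_relPrec hul huh
  have hwr : RelPrec (2 * dotPrec m ul uh) (∑ s ∈ Finset.Ici i, β * v r * f s) (w r) := by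
    rw [← Finset.mul_sum, mul_right_comm]
    exact (((hround hq).mul (.refl le_rfl (v r))).trans (hround (hw r hr))).mono (by linarith)
  obtain ⟨g, hg, hwg⟩ := hwr.exists_eq_sum
  obtain ⟨s, hs, hys⟩ := hround (hy r hr)
  refine ⟨Real.exp s * x r, fun k => Real.exp s * g k, ⟨s, ?_, rfl⟩, fun k => ?_, ?_⟩
  · linarith [hβ.nonneg, (hv r).nonneg, (hf r).nonneg]
  · have hfk : RelPrec (ε' + dotPrec m ul uh) (V k * x k) (f k) :=
      (((hv k).mul (.refl le_rfl (x k))).mono (by linarith)).trans (hf k)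
    have hgk := ((hβ.mul (hv r)).mul hfk).trans (hg k)
    exact (hgk.trans ⟨s, hs, rfl⟩).mono (by linarith)
  · rw [hys, hwg, mul_sub, Finset.mul_sum]

theorem HHApply.abs_sub_le (hul : ul ≤ 1 / 2) (huh : uh ∈ Set.Icc 0 (1 / 2))
    {ε ε' b : ℝ} {V y : Fin m → ℝ} (hβ : RelPrec ε b β) (hv : ∀ r, RelPrec ε' (V r) (v r))
    (hV : ∀ r < i, V r = 0) (h : HHApply ul uh i v β x y) (r : Fin m) :
    |y r - (x r - b * (V ⬝ᵥ x) * V r)| ≤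
      (Real.exp (ε + 2 * ε' + 4 * dotPrec m ul uh) - 1) *
        (|x r| + |b| * |V r| * ∑ s, |V s| * |x s|) := by
  rcases lt_or_ge r i with hri | hri
  · have hτ : 0 ≤ ε + 2 * ε' + 4 * dotPrec m ul uh := by
      obtain ⟨_, _, hx, -⟩ := h.exists_relPrec hul huh hβ hv le_rfl
      exact hx.nonneg
    have hexp := sub_nonneg.2 (Real.one_le_exp hτ)
    rw [h.1 r hri, hV r hri, mul_zero, sub_zero, sub_self, abs_zero]
    positivity
  · obtain ⟨a, g, ha, hg, hy⟩ := h.exists_relPrec hul huh hβ hv hri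
    set κ := Real.exp (ε + 2 * ε' + 4 * dotPrec m ul uh) - 1
    have hκ : 0 ≤ κ := sub_nonneg.2 (Real.one_le_exp ha.nonneg)
    have hdot : b * (V ⬝ᵥ x) * V r = ∑ s ∈ Finset.Ici i, b * V r * (V s * x s) := by
      rw [mul_right_comm, dotProduct, Finset.mul_sum]
      refine (Finset.sum_subset (Finset.subset_univ _) fun s _ hs => ?_).symm
      rw [hV s (not_le.1 (mt Finset.mem_Ici.2 hs)), zero_mul, mul_zero]
    calc |y r - (x r - b * (V ⬝ᵥ x) * V r)|
        = |(a - x r) - ∑ s ∈ Finset.Ici i, (g s - b * V r * (V s * x s))| := by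
          rw [hy, hdot, Finset.sum_sub_distrib]
          ring_nf
      _ ≤ |a - x r| + ∑ s ∈ Finset.Ici i, |g s - b * V r * (V s * x s)| :=
          (abs_sub _ _).trans (by gcongr; exact Finset.abs_sum_le_sum_abs _ _)
      _ ≤ κ * |x r| + ∑ s, κ * (|b| * |V r| * (|V s| * |x s|)) := by
          refine add_le_add ha.abs_sub_le <| (Finset.sum_le_sum fun s _ => ?_).trans <|
            Finset.sum_le_univ_sum_of_nonneg fun s => by positivity
          simpa only [abs_mul] using (hg s).abs_sub_le
      _ = κ * (|x r| + |b| * |V r| * ∑ s, |V s| * |x s|) := by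
          rw [← Finset.mul_sum, ← Finset.mul_sum, mul_add]

theorem mul_exp_sub_one_le (k : ℕ) (t : ℝ) : k * (Real.exp t - 1) ≤ Real.exp (k * t) - 1 := by
  rw [Real.exp_nat_mul]
  linarith [one_add_mul_sub_le_pow (by linarith [Real.exp_pos t] : -1 ≤ Real.exp t) k]

theorem HHApply.norm_sub_exactP_mulVec_le (hul : ul ∈ Set.Icc 0 (1 / 2))
    (huh : uh ∈ Set.Icc 0 (1 / 2)) (hvec : HHVec ul uh i x v β σ) {y z : Fin m → ℝ}
    (h : HHApply ul uh i v β y z) :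
    ‖toLp 2 (z - exactP i x *ᵥ y)‖ ≤ (Real.exp (54 * dotPrec m ul uh) - 1) * ‖toLp 2 y‖ := by
  obtain ⟨-, hβ, hv⟩ := hvec.relPrec hul huh
  set ε := dotPrec m ul uh
  set V := exactV i x
  set b := exactBeta i x
  set κ := Real.exp (18 * ε) - 1
  have hκ : 0 ≤ κ := sub_nonneg.2 (one_le_exp_mul_dotPrec hul.1 huh.1 18)
  have hcomp (r : Fin m) : |(z - exactP i x *ᵥ y) r| ≤
      κ * |y r| + κ * (|b| * (‖toLp 2 V‖ * ‖toLp 2 y‖)) * |V r| := by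
    have hV : ∀ r < i, V r = 0 := fun r hr => if_pos hr
    rw [Pi.sub_apply, exactP_mulVec]
    calc _ ≤ κ * (|y r| + |b| * |V r| * ∑ s, |V s| * |y s|) :=
          (h.abs_sub_le hul.2 huh hβ hv hV r).trans_eq (by simp only [κ, ε]; ring_nf)
      _ ≤ κ * (|y r| + |b| * |V r| * (‖toLp 2 V‖ * ‖toLp 2 y‖)) := by
          gcongr
          exact sum_abs_mul_abs_le V y
      _ = _ := by ring
  calc ‖toLp 2 (z - exactP i x *ᵥ y)‖
      ≤ κ * ‖toLp 2 y‖ + κ * (|b| * (‖toLp 2 V‖ * ‖toLp 2 y‖)) * ‖toLp 2 V‖ :=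
        norm_toLp_le_add hκ (by positivity) hcomp
    _ = κ * ‖toLp 2 y‖ * (1 + |b| * ‖toLp 2 V‖ ^ 2) := by ring
    _ ≤ κ * ‖toLp 2 y‖ * (1 + 2) := by
        gcongr
        exact abs_exactBeta_mul_norm_sq_le i x
    _ = (3 * κ) * ‖toLp 2 y‖ := by ring
    _ ≤ (Real.exp (54 * ε) - 1) * ‖toLp 2 y‖ := by
        gcongr
        exact (mul_exp_sub_one_le 3 (18 * ε)).trans_eq (by push_cast; ring_nf)

theorem HHVec.norm_sub_exactP_mulVec_self_le (hul : ul ∈ Set.Icc 0 (1 / 2))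
    (huh : uh ∈ Set.Icc 0 (1 / 2)) (hvec : HHVec ul uh i x v β σ) {z : Fin m → ℝ}
    (h_above : ∀ r < i, z r = x r) (h_i : z i = σ) (h_below : ∀ r, i < r → z r = 0) :
    ‖toLp 2 (z - exactP i x *ᵥ x)‖ ≤ (Real.exp (54 * dotPrec m ul uh) - 1) * ‖toLp 2 x‖ := by
  obtain ⟨hσ, -, -⟩ := hvec.relPrec hul huh
  set κ := Real.exp (54 * dotPrec m ul uh) - 1
  have hκ : 0 ≤ κ := sub_nonneg.2 (one_le_exp_mul_dotPrec hul.1 huh.1 54)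
  rw [← norm_toLp_mulVec_of_mem_orthogonalGroup (exactP_mem_orthogonalGroup i x) x,
    ← Real.norm_of_nonneg hκ, ← norm_smul, ← WithLp.toLp_smul]
  refine norm_toLp_le_of_abs_le fun r => ?_
  rw [Pi.sub_apply, Pi.smul_apply, smul_eq_mul, abs_mul, abs_of_nonneg hκ, exactP_mulVec_self]
  rcases lt_trichotomy r i with hr | rfl | hr
  · rw [h_above r hr, if_pos hr, sub_self, abs_zero]
    positivity
  · rw [h_i, if_neg (lt_irrefl r), if_pos rfl]
    exact (hσ.mono (by linarith [dotPrec_nonneg (m := m) hul.1 huh.1])).abs_sub_le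
  · rw [h_below r hr, if_neg hr.not_gt, if_neg hr.ne', sub_self, abs_zero]
    positivity

end Computed

/-! ### Accumulation of errors under nonexpansive maps -/

section Accumulation

variable {R E : Type*} [Semiring R] [SeminormedAddCommGroup E] [Module R E] {n : ℕ}
  {P : Fin n → E →L[R] E} {y : Fin (n + 1) → E} {a : ℝ}

theorem norm_list_prod_apply_le {l : List (E →L[R] E)} (hl : ∀ T ∈ l, ∀ x, ‖T x‖ ≤ ‖x‖) (x : E) :
    ‖l.prod x‖ ≤ ‖x‖ := by
  induction l with
  | nil => simp
  | cons T l ih =>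
    obtain ⟨hT, hl⟩ := List.forall_mem_cons.1 hl
    exact (hT (l.prod x)).trans (ih hl)

theorem norm_sub_prod_apply_le (ha : 1 ≤ a) (hP : ∀ i x, ‖P i x‖ ≤ ‖x‖)
    (h : ∀ i, ‖y i.castSucc - P i (y i.succ)‖ ≤ (a - 1) * ‖y i.succ‖) :
    ‖y 0 - (List.ofFn P).prod (y (Fin.last n))‖ ≤ (a ^ n - 1) * ‖y (Fin.last n)‖ := by
  induction n with
  | zero => simp
  | succ n ih =>
    set T := (List.ofFn fun i : Fin n => P i.succ).prod
    set z := y (Fin.last (n + 1))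
    have htail : ‖y 1 - T z‖ ≤ (a ^ n - 1) * ‖z‖ :=
      ih (y := fun k => y k.succ) (fun i => hP i.succ) fun i => h i.succ
    have hfirst : ‖y 1‖ ≤ a ^ n * ‖z‖ := by
      have hTz : ‖T z‖ ≤ ‖z‖ :=
        norm_list_prod_apply_le (List.forall_mem_ofFn_iff.2 fun i => hP i.succ) z
      linarith [norm_sub_norm_le (y 1) (T z)]
    calc ‖y 0 - (List.ofFn P).prod z‖ = ‖(y 0 - P 0 (y 1)) + P 0 (y 1 - T z)‖ := by
          rw [map_sub, sub_add_sub_cancel, List.ofFn_succ, List.prod_cons]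
          rfl
      _ ≤ ‖y 0 - P 0 (y 1)‖ + ‖y 1 - T z‖ :=
          (norm_add_le _ _).trans (add_le_add_right (hP 0 _) _)
      _ ≤ (a - 1) * (a ^ n * ‖z‖) + (a ^ n - 1) * ‖z‖ :=
          add_le_add ((h 0).trans (mul_le_mul_of_nonneg_left hfirst (sub_nonneg.2 ha))) htail
      _ = (a ^ (n + 1) - 1) * ‖z‖ := by ring

theorem norm_sub_reverse_prod_apply_le (ha : 1 ≤ a) (hP : ∀ i x, ‖P i x‖ ≤ ‖x‖)
    (h : ∀ i, ‖y i.succ - P i (y i.castSucc)‖ ≤ (a - 1) * ‖y i.castSucc‖) :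
    ‖y (Fin.last n) - (List.ofFn P).reverse.prod (y 0)‖ ≤ (a ^ n - 1) * ‖y 0‖ := by
  have hrev : (List.ofFn P).reverse = List.ofFn (P ∘ Fin.rev) := by
    rw [List.ofFn_eq_map, List.ofFn_eq_map, ← List.map_reverse, List.finRange_reverse,
      List.map_map]
  have hle := norm_sub_prod_apply_le (P := P ∘ Fin.rev) (y := y ∘ Fin.rev) ha (fun i => hP _)
    fun i => by simpa [Fin.rev_castSucc, Fin.rev_succ] using h i.rev
  simpa [hrev] using hle

end Accumulation

/-! ### Executions of the algorithm -/

section ThinId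

variable {m n : ℕ}

theorem thinId_transpose_mul {k : ℕ} (hnm : n ≤ m) (M : Matrix (Fin m) (Fin k) ℝ) :
    (thinId m n)ᵀ * M = M.submatrix (Fin.castLE hnm) id := by
  ext r j
  simp only [Matrix.mul_apply, Matrix.transpose_apply, thinId, Matrix.of_apply, ite_mul, one_mul,
    zero_mul, Matrix.submatrix_apply, id_eq]
  rw [Finset.sum_eq_single (Fin.castLE hnm r)] <;> simp +contextual [Fin.ext_iff]

theorem norm_col_thinId (hnm : n ≤ m) (j : Fin n) : ‖toLp 2 ((thinId m n).col j)‖ = 1 := by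
  have hcol : (thinId m n).col j = Pi.single (Fin.castLE hnm j) 1 := by
    ext r
    simp [thinId, Pi.single_apply, Fin.ext_iff]
  rw [hcol, PiLp.toLp_single, PiLp.norm_single, norm_one]

end ThinId

namespace Run

variable {m n : ℕ} {hnm : n ≤ m} {ul uh : ℝ} {A : Matrix (Fin m) (Fin n) ℝ}

theorem W_eq_zero (run : Run hnm ul uh A) {k : Fin (n + 1)} {j : Fin n} {r : Fin m}
    (hk : j.castSucc < k) (hr : (j : ℕ) < r) : run.W k r j = 0 := by
  induction k using Fin.induction with
  | zero => exact absurd hk (Fin.not_lt_zero _)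
  | succ i ih =>
    rcases (Fin.castSucc_lt_succ_iff.1 hk).eq_or_lt with rfl | hji
    · exact run.W_below j r hr
    · rw [run.W_left i j hji]
      exact ih hji

theorem norm_toEuclideanCLM_P_apply (run : Run hnm ul uh A) (i : Fin n)
    (x : EuclideanSpace ℝ (Fin m)) : ‖Matrix.toEuclideanCLM (𝕜 := ℝ) (run.P i) x‖ = ‖x‖ :=
  norm_toLp_mulVec_of_mem_orthogonalGroup (exactP_mem_orthogonalGroup _ _) x.ofLp

theorem norm_W_succ_sub_le (hul : ul ∈ Set.Icc 0 (1 / 2)) (huh : uh ∈ Set.Icc 0 (1 / 2))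
    (run : Run hnm ul uh A) (i j : Fin n) :
    ‖toLp 2 ((run.W i.succ).col j - run.P i *ᵥ (run.W i.castSucc).col j)‖ ≤
      (Real.exp (54 * dotPrec m ul uh) - 1) * ‖toLp 2 ((run.W i.castSucc).col j)‖ := by
  rcases lt_trichotomy j i with hji | rfl | hij
  · have hcol : (run.W i.succ).col j = (run.W i.castSucc).col j := funext (run.W_left i j hji)
    have hzero (r : Fin m) (hr : Fin.castLE hnm i ≤ r) : (run.W i.castSucc).col j r = 0 :=
      run.W_eq_zero hji (lt_of_lt_of_le hji hr)
    rw [hcol, P, exactP_mulVec_eq_self hzero, sub_self, WithLp.toLp_zero, norm_zero]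
    exact mul_nonneg (sub_nonneg.2 (one_le_exp_mul_dotPrec hul.1 huh.1 54)) (norm_nonneg _)
  · exact (run.hhvec j).norm_sub_exactP_mulVec_self_le hul huh (run.W_above j) (run.W_diag j)
      (run.W_below j)
  · exact (run.W_right i j hij).norm_sub_exactP_mulVec_le hul huh (run.hhvec i)

theorem colNorm_Rhat_sub_R_le (hul : ul ∈ Set.Icc 0 (1 / 2)) (huh : uh ∈ Set.Icc 0 (1 / 2))
    (run : Run hnm ul uh A) (j : Fin n) :
    colNorm (run.Rhat - run.R) j ≤
      (Real.exp (54 * dotPrec m ul uh) ^ n - 1) * colNorm A j := by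
  have hW := norm_sub_reverse_prod_apply_le (P := Matrix.toEuclideanCLM (𝕜 := ℝ) ∘ run.P)
    (y := fun k => toLp 2 ((run.W k).col j))
    (a := Real.exp (54 * dotPrec m ul uh)) (one_le_exp_mul_dotPrec hul.1 huh.1 54)
    (fun i x => by rw [Function.comp_apply, run.norm_toEuclideanCLM_P_apply])
    fun i => by
      rw [Function.comp_apply, Matrix.toEuclideanCLM_toLp, ← WithLp.toLp_sub]
      exact run.norm_W_succ_sub_le hul huh i j
  rw [← List.map_ofFn, ← List.map_reverse, ← map_list_prod, Matrix.toEuclideanCLM_toLp,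
    ← WithLp.toLp_sub, ← colNorm_sub_mul, run.W_zero] at hW
  have hsub : run.Rhat - run.R = (run.W (Fin.last n) - (List.ofFn run.P).reverse.prod * A).submatrix
      (Fin.castLE hnm) id := by
    rw [Rhat, R, thinId_transpose_mul hnm]
    rfl
  rw [hsub]
  exact (colNorm_submatrix_le _ (Fin.castLE_injective hnm) j).trans hW

theorem colNorm_Qhat_sub_Q_le (hul : ul ∈ Set.Icc 0 (1 / 2)) (huh : uh ∈ Set.Icc 0 (1 / 2))
    (run : Run hnm ul uh A) (j : Fin n) :
    colNorm (run.Qhat - run.Q) j ≤ Real.exp (54 * dotPrec m ul uh) ^ n - 1 := by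
  have hX := norm_sub_prod_apply_le (P := Matrix.toEuclideanCLM (𝕜 := ℝ) ∘ run.P)
    (y := fun k => toLp 2 ((run.X k).col j))
    (a := Real.exp (54 * dotPrec m ul uh)) (one_le_exp_mul_dotPrec hul.1 huh.1 54)
    (fun i x => by rw [Function.comp_apply, run.norm_toEuclideanCLM_P_apply])
    fun i => by
      rw [Function.comp_apply, Matrix.toEuclideanCLM_toLp, ← WithLp.toLp_sub]
      exact (run.X_step i j).norm_sub_exactP_mulVec_le hul huh (run.hhvec i)
  rwa [← List.map_ofFn, ← map_list_prod, Matrix.toEuclideanCLM_toLp, ← WithLp.toLp_sub,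
    ← colNorm_sub_mul, run.X_last, norm_col_thinId hnm, mul_one] at hX

end Run

/-! ### The constants -/

section GammaTilde

variable {c k m n : ℕ} {u ul uh : ℝ}

theorem mul_le_gammaTilde (hu : 0 ≤ u) (h : c * k * u < 1) : c * k * u ≤ gammaTilde c k u := by
  have hnonneg : 0 ≤ c * k * u := by positivity
  exact le_div_self hnonneg (sub_pos.2 h) (sub_le_self 1 hnonneg)

theorem le_half_of_mul_lt_one (hu : 0 ≤ u) (hck : 2 ≤ c * k) (h : c * k * u < 1) : u ≤ 1 / 2 := by
  have hck' : (2 : ℝ) ≤ c * k := by exact_mod_cast hck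
  nlinarith

theorem exp_dotPrec_pow_sub_one_le (hc : 216 ≤ c) (hul : 0 ≤ ul) (huh : 0 ≤ uh)
    (hcl : c * (10 * n : ℕ) * ul < 1) (hch : c * m * uh < 1)
    (hγh : n * gammaTilde c m uh ≤ 1 / 2) :
    Real.exp (54 * dotPrec m ul uh) ^ n - 1 ≤
      gammaTilde c (10 * n) ul + n * gammaTilde c m uh := by
  have hc' : (216 : ℝ) ≤ c := by exact_mod_cast hc
  set t : ℝ := n * (54 * dotPrec m ul uh) with ht
  have hl : 2160 * (n * ul) ≤ c * (10 * n : ℕ) * ul := by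
    calc 2160 * (n * ul) = 216 * (10 * n : ℕ) * ul := by push_cast; ring
      _ ≤ c * (10 * n : ℕ) * ul := by gcongr
  have hh : 216 * (n * (m * uh)) ≤ n * gammaTilde c m uh := by
    calc 216 * (n * (m * uh)) = n * (216 * m * uh) := by ring
      _ ≤ n * (c * m * uh) := by gcongr
      _ ≤ n * gammaTilde c m uh := by gcongr; exact mul_le_gammaTilde huh hch
  have ht_eq : t = 108 * (n * ul) + 108 * (n * (m * uh)) := by
    rw [ht, dotPrec]
    ring
  have ht₀ : 0 ≤ t := ht_eq ▸ by positivity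
  have hnl : 0 ≤ n * ul := by positivity
  have hexp := Real.abs_exp_sub_one_le (x := t) (by rw [abs_of_nonneg ht₀]; linarith)
  rw [abs_of_nonneg ht₀] at hexp
  rw [← Real.exp_nat_mul]
  linarith [le_abs_self (Real.exp t - 1), mul_le_gammaTilde hul hcl]

end GammaTilde

end MPHQR

open MPHQR in
theorem mainTheorem1_general {c m n : ℕ} (hc : 216 ≤ c) (hnm : n ≤ m) {ul uh : ℝ} (hul : 0 ≤ ul)
    (huh : 0 ≤ uh) (hcl : (c : ℝ) * (10 * n : ℕ) * ul < 1) (hch : (c : ℝ) * m * uh < 1)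
    (hγh : n * gammaTilde c m uh ≤ 1 / 2) {A : Matrix (Fin m) (Fin n) ℝ} (run : Run hnm ul uh A) :
    (∀ j : Fin n, colNorm (run.Rhat - run.R) j ≤
        (gammaTilde c (10 * n) ul + n * gammaTilde c m uh) * colNorm A j) ∧
      ‖run.Rhat - run.R‖ ≤ (gammaTilde c (10 * n) ul + n * gammaTilde c m uh) * ‖A‖ ∧
      (∀ j : Fin n, colNorm (run.Qhat - run.Q) j ≤
        gammaTilde c (10 * n) ul + n * gammaTilde c m uh) ∧
      ‖run.Qhat - run.Q‖ ≤ √n * (gammaTilde c (10 * n) ul + n * gammaTilde c m uh) := by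
  set Γ := gammaTilde c (10 * n) ul + n * gammaTilde c m uh
  have hκ := exp_dotPrec_pow_sub_one_le hc hul huh hcl hch hγh
  have hΓ : 0 ≤ Γ := hκ.trans' <| sub_nonneg.2 <|
    one_le_pow₀ (one_le_exp_mul_dotPrec hul huh 54)
  have hul' (j : Fin n) : ul ∈ Set.Icc 0 (1 / 2) :=
    ⟨hul, le_half_of_mul_lt_one hul (by nlinarith [j.pos]) hcl⟩
  have huh' (j : Fin n) : uh ∈ Set.Icc 0 (1 / 2) :=
    ⟨huh, le_half_of_mul_lt_one huh (by nlinarith [j.pos]) hch⟩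
  have hR (j : Fin n) : colNorm (run.Rhat - run.R) j ≤ Γ * colNorm A j :=
    (run.colNorm_Rhat_sub_R_le (hul' j) (huh' j) j).trans
      (mul_le_mul_of_nonneg_right hκ (colNorm_nonneg A j))
  have hQ (j : Fin n) : colNorm (run.Qhat - run.Q) j ≤ Γ :=
    (run.colNorm_Qhat_sub_Q_le (hul' j) (huh' j) j).trans hκ
  exact ⟨hR, norm_le_mul_of_colNorm_le hΓ hR, hQ, norm_le_sqrt_mul_of_colNorm_le hΓ hQ⟩

/-- Columnwise and Frobenius norm error bounds for mixed precision Householder QR; the norm of a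
matrix is its Frobenius norm, and `c` is the absolute constant of the `γ̃` notation. -/
theorem mainTheorem1 :
    ∃ c : ℕ, 0 < c ∧
      ∀ (m n : ℕ) (hnm : n ≤ m) (ul uh : ℝ), 0 < uh → uh ≤ ul →
        (c : ℝ) * (10 * n : ℕ) * ul < 1 → MPHQR.gammaTilde c (10 * n) ul ≤ 1 / 2 →
        (c : ℝ) * m * uh < 1 → n * MPHQR.gammaTilde c m uh ≤ 1 / 2 →
        ∀ A : Matrix (Fin m) (Fin n) ℝ, A.rank = n →
          ∀ run : MPHQR.Run hnm ul uh A,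
            (∀ j : Fin n, MPHQR.colNorm (run.Rhat - run.R) j ≤
              (MPHQR.gammaTilde c (10 * n) ul + n * MPHQR.gammaTilde c m uh) *
                MPHQR.colNorm A j) ∧
            ‖run.Rhat - run.R‖ ≤
              (MPHQR.gammaTilde c (10 * n) ul + n * MPHQR.gammaTilde c m uh) * ‖A‖ ∧
            (∀ j : Fin n, MPHQR.colNorm (run.Qhat - run.Q) j ≤
              MPHQR.gammaTilde c (10 * n) ul + n * MPHQR.gammaTilde c m uh) ∧
            ‖run.Qhat - run.Q‖ ≤
              Real.sqrt n *
                (MPHQR.gammaTilde c (10 * n) ul + n * MPHQR.gammaTilde c m uh) :=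
  ⟨216, by norm_num, fun _ _ hnm _ _ huh hle hcl _ hch hγh _ _ run =>
    mainTheorem1_general le_rfl hnm (huh.le.trans hle) huh.le hcl hch hγh run⟩
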